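/- Work over $\mathbb{C}$. Let $M$ be a $3\times 3$ matrix of linear forms and $L_1,L_2,L_3$ linear forms on $V=\mathbb{C}^6$, and let $X\subset\mathbb{P}(V)=\mathbb{P}^5$ be defined by $\det M+L_1L_2L_3=0$. Let $V^\perp\subset\mathbb{C}^{9}\oplus\mathbb{C}^3$ be the kernel of $(M_{11},\dots,M_{33},L_1,L_2,L_3)\colon \mathbb{C}^{9}\oplus\mathbb{C}^3\to V^*$, and let $M'$, $L'_1,L'_2,L'_3$ denote the $3\times3$ matrix of linear forms and the linear forms on $V^\perp$ given by the coordinates of $\mathbb{C}^{9}\oplus\mathbb{C}^3$ (the Gale dual forms). Let $V_6=E\oplus F$ with $E=F=\mathbb{C}^3$, let $e_1,e_2,e_3$ and $f_1,f_2,f_3$ be the standard bases of $E^*$ and $F^*$, and put $\hat e_1=e_2\wedge e_3$, $\hat e_2=-e_1\wedge e_3$, $\hat e_3=e_1\wedge e_2$, and similarly $\hat f_j$. Define the linear forms $M_E=(\hat e_i\wedge f_j)_{ij}$, $L_E=e_1\wedge e_2\wedge e_3$, $M_F=(e_i\wedge\hat f_j)_{ij}$, $L_F=-f_1\wedge f_2\wedge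 f_3$ on $\Lambda^3V_6$; together they form a coordinate system. For $\{i,j,k\}=\{1,2,3\}$ let $A_i\subset\Lambda^3V_6$ be the Lagrangian subspace of all $x$ for which there are $v\in V$ and $w\in V^\perp$ with $$M_E(x)=M(v),\quad L_E(x)=L_i(v),\quad M_F(x)=M'(w),\quad L_F(x)=L_i'(w),\quad L_j(v)=L_k'(w),\quad L_k(v)=L_j'(w);$$ we then say that $x\in A_i$ maps to $v$. Let $$Y_{A_i^\perp}=\{V_5\in\mathbb{P}(V_6^*)\mid \dim(A_i\cap\Lambda^3V_5)\ge 1\}$$ be the associated EPW sextic. Let $(e,f)\in E^*\oplus F^*$ with $e\neq0$, regarded as column vectors of coordinates, be such that $\Pi_i(e,f)=\{Mf+eL_i=0\}\subset\mathbb{P}^5$ is a plane and $\Gamma_i(f)=\{Mf=0,\ L_i=0\}$ is a line, and let $C_i(e,f)\subset\Pi_i(e,f)$ be the conic residual to $\Gamma_i(f)$ in $X\cap\Pi_i(e,f)$, i.e. the scheme $q=0$, where $q$ is the unique quadratic form on (the cone over) $\Pi_i(e,f)$ with $\det M+L_1L_2L_3=L_i\cdot q$ there (if $X$ contains $\Pi_i(e,f)$,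 then $q=0$ and every point of the plane counts as singular). Put $\sigma=\operatorname{tr}(M_EM_F^t)+L_EL_F$ and let $\widetilde C_i(e,f)$ be the quadric in the linear space $\widetilde\Pi_i(e,f)=\{M_Ef+eL_E=0\}\subset\mathbb{P}(\Lambda^3V_6)$ residual to $\{M_Ef=0,\ L_E=0\}$ in the intersection of $\widetilde\Pi_i(e,f)$ with the cubic $2\det M_E-\sigma L_E=0$; its equation is again unique. Suppose that $(e,f)$ is a point of $Y_{A_i^\perp}$, and let $V_5\subset V_6$ be the hyperplane defined by $e+f\in V_6^*$. Then the conic $C_i(e,f)$ is singular. More precisely, let $x$ be any nonzero vector of $A_i\cap\Lambda^3V_5$. Then: 1. $[x]$ lies on $\widetilde C_i(e,f)$, and $\widetilde H_x=\{y\in\Lambda^3V_6\mid x\wedge y=0\}$ is tangent to $\widetilde C_i(e,f)$ at $[x]$; precisely, the embedded tangent space of $\widetilde C_i(e,f)$ at $[x]$ is $\widetilde\Pi_i(e,f)\cap\widetilde H_x$. 2. Every $v\in V$ to which $x$ maps is nonzero, and $[v]$ lies in $\Pi_i(e,f)$ and is a singular point of $C_i(e,f)$. -/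

import Mathlib

open scoped LinearAlgebra.Projectivization

noncomputable section

namespace GaleEPW

/-- The vector space `V = ℂ⁶`; the cubic fourfold lives in `ℙ(V) = ℙ⁵`. -/
abbrev V : Type := Fin 6 → ℂ

/-- `V₆ = E ⊕ F` with `E = F = ℂ³`. -/
abbrev V6 : Type := (Fin 3 → ℂ) × (Fin 3 → ℂ)

/-- The symplectic space `Λ³V₆`. -/
abbrev L3 : Type := ⋀[ℂ]^3 V6

/-! ### The cubic fourfold `X`, the plane `Π_i(e,f)` and the line `Γ_i(f)`

A `3 × 3` matrix of linear forms on `V` is a linear map `M : V → Mat₃(ℂ)`. -/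

/-- The equation `det M + L₁ L₂ L₃` of `X ⊂ ℙ(V)`. -/
def cubic (M : V →ₗ[ℂ] Matrix (Fin 3) (Fin 3) ℂ) (L : Fin 3 → Module.Dual ℂ V) (v : V) : ℂ :=
  (M v).det + L 0 v * L 1 v * L 2 v

/-- (The cone over) `Π_i(e,f)`, given by `M f + e L_i = 0`. -/
def planeSpace (M : V →ₗ[ℂ] Matrix (Fin 3) (Fin 3) ℂ) (L : Fin 3 → Module.Dual ℂ V) (i : Fin 3)
    (e f : Fin 3 → ℂ) : Submodule ℂ V where
  carrier := {v | (M v).mulVec f + L i v • e = 0}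
  zero_mem' := by simp
  add_mem' := by
    intro a b ha hb
    simp only [Set.mem_ofPred_eq] at *
    rw [map_add, map_add, Matrix.add_mulVec, add_smul, add_add_add_comm, ha, hb, add_zero]
  smul_mem' := by
    intro c a ha
    simp only [Set.mem_ofPred_eq] at *
    rw [map_smul, map_smul, Matrix.smul_mulVec, smul_assoc, ← smul_add, ha, smul_zero]

/-- (The cone over) `Γ_i(f)`, given by `M f = 0` and `L_i = 0`. -/
def lineSpace (M : V →ₗ[ℂ] Matrix (Fin 3) (Fin 3) ℂ) (L : Fin 3 → Module.Dual ℂ V) (i : Fin 3)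
    (f : Fin 3 → ℂ) : Submodule ℂ V where
  carrier := {v | (M v).mulVec f = 0 ∧ L i v = 0}
  zero_mem' := by simp
  add_mem' := by
    rintro a b ⟨ha, ha'⟩ ⟨hb, hb'⟩
    exact ⟨by rw [map_add, Matrix.add_mulVec, ha, hb, add_zero],
      by rw [map_add, ha', hb', add_zero]⟩
  smul_mem' := by
    rintro c a ⟨ha, ha'⟩
    exact ⟨by rw [map_smul, Matrix.smul_mulVec, ha, smul_zero],
      by rw [map_smul, ha', smul_zero]⟩

/-! ### Residual quadrics, tangent spaces, singular points -/

section Quadrics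

variable {W : Type*} [AddCommGroup W] [Module ℂ W]

/-- `q` is the equation of the quadric in `ℙ(S)` residual to the hyperplane `l = 0` of `ℙ(S)` in
the intersection of `ℙ(S)` with the cubic hypersurface `F = 0`: one has `F = l · q` on `S`. -/
def IsResidualQuadric (S : Submodule ℂ W) (F : W → ℂ) (l : Module.Dual ℂ W)
    (q : QuadraticForm ℂ S) : Prop :=
  ∀ w : S, F w = l w * q w

/-- (The cone over) the embedded tangent space at `[p]` of the quadric `q = 0`: the kernel of the
differential `q(p + w) - q(p) - q(w)` of `q` at `p`. -/
def tangentSpace (q : QuadraticForm ℂ W) (p : W) : Submodule ℂ W :=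
  LinearMap.ker (q.polarBilin p)

/-- `[p]` is a singular point of the quadric `q = 0` in `ℙ(W)`. -/
def IsSingularPoint (q : QuadraticForm ℂ W) (p : W) : Prop :=
  p ≠ 0 ∧ q p = 0 ∧ tangentSpace q p = ⊤

end Quadrics

/-! ### Coordinates on `Λ³V₆` -/

/-- The coordinate `e_i ∈ V₆^*` on `E`. -/
def eForm (i : Fin 3) : Module.Dual ℂ V6 :=
  LinearMap.proj i ∘ₗ LinearMap.fst ℂ (Fin 3 → ℂ) (Fin 3 → ℂ)

/-- The coordinate `f_j ∈ V₆^*` on `F`. -/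
def fForm (j : Fin 3) : Module.Dual ℂ V6 :=
  LinearMap.proj j ∘ₗ LinearMap.snd ℂ (Fin 3 → ℂ) (Fin 3 → ℂ)

/-- `a ∧ b ∧ c ∈ Λ³V₆^*`, as a linear form on `Λ³V₆`. -/
def wedge3 (a b c : Module.Dual ℂ V6) : Module.Dual ℂ L3 :=
  exteriorPower.pairingDual ℂ V6 3 (exteriorPower.ιMulti ℂ 3 ![a, b, c])

/-- `M_E = (ê_i ∧ f_j)`. The indices are cyclic modulo `3`, so that
`ê_i = e_{i+1} ∧ e_{i+2}` is `e₂ ∧ e₃`, `-e₁ ∧ e₃`, `e₁ ∧ e₂` in the numbering from `1` to `3`. -/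
def matE (x : L3) : Matrix (Fin 3) (Fin 3) ℂ :=
  Matrix.of fun i j => wedge3 (eForm (i + 1)) (eForm (i + 2)) (fForm j) x

/-- `L_E = e₁ ∧ e₂ ∧ e₃`. -/
def linE : Module.Dual ℂ L3 := wedge3 (eForm 0) (eForm 1) (eForm 2)

/-- `M_F = (e_i ∧ f̂_j)`, with `f̂_j = f_{j+1} ∧ f_{j+2}`. -/
def matF (x : L3) : Matrix (Fin 3) (Fin 3) ℂ :=
  Matrix.of fun i j => wedge3 (eForm i) (fForm (j + 1)) (fForm (j + 2)) x

/-- `L_F = -f₁ ∧ f₂ ∧ f₃`. -/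
def linF : Module.Dual ℂ L3 := -wedge3 (fForm 0) (fForm 1) (fForm 2)

lemma matE_add (x y : L3) : matE (x + y) = matE x + matE y := by
  ext i j; simp [matE]

lemma matE_smul (c : ℂ) (x : L3) : matE (c • x) = c • matE x := by
  ext i j; simp [matE]

lemma matF_add (x y : L3) : matF (x + y) = matF x + matF y := by
  ext i j; simp [matF]

lemma matF_smul (c : ℂ) (x : L3) : matF (c • x) = c • matF x := by
  ext i j; simp [matF]

/-! ### Gale duality and the Lagrangian `A_i` -/

/-- The domain `V^⊥` of the Gale dual forms: the kernel of `(M, L₁, L₂, L₃) : ℂ⁹ ⊕ ℂ³ → V^*`.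
The Gale dual forms are the coordinates of `k ∈ V^⊥`, namely `M'(k) = k.1`, `L_i'(k) = k.2 i`. -/
def galeKernel (M : V →ₗ[ℂ] Matrix (Fin 3) (Fin 3) ℂ) (L : Fin 3 → Module.Dual ℂ V) :
    Submodule ℂ (Matrix (Fin 3) (Fin 3) ℂ × (Fin 3 → ℂ)) where
  carrier := {k | ∀ v : V, ∑ a, ∑ b, k.1 a b * M v a b + ∑ a, k.2 a * L a v = 0}
  zero_mem' := by simp
  add_mem' := by
    intro k l hk hl v
    have h := congrArg₂ (· + ·) (hk v) (hl v)
    simp only [add_zero] at h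
    rw [← h]
    simp only [Prod.fst_add, Prod.snd_add, Matrix.add_apply, Pi.add_apply, add_mul,
      Finset.sum_add_distrib]
    ring
  smul_mem' := by
    intro c k hk v
    have h := congrArg (c * ·) (hk v)
    simp only [mul_zero] at h
    rw [← h]
    simp only [Prod.smul_fst, Prod.smul_snd, Matrix.smul_apply, Pi.smul_apply, smul_eq_mul,
      mul_add, Finset.mul_sum, mul_assoc]

/-- `x ∈ A_i`, and its image under the projection from the vertex `ℙ(A_F)` is `v`.

Write `{i, j, k} = {1, 2, 3}`. In the coordinates `(M_E, L_E; M_F, L_F)` of `Λ³V₆ = U_E ⊕ U_F`, the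
elements of `A_i` are the `(M(v), L_i(v); M'(w), L_i'(w))` with `v ∈ V`, `w ∈ V^⊥`,
`L_j(v) = L_k'(w)` and `L_k(v) = L_j'(w)`. In bases of `V` and of `V^⊥` in which `(L_k, L_j)` resp.
`(L_j', L_k')` are the last two coordinates, this is the column space of the block matrix
`(0, Q₂, Q₃, Q₄; P₁, 0, P₃, P₄)`, where `(Q₂, Q₃, Q₄)` and `(P₁, P₃, P₄)` are the coefficient
matrices of `(M, L_i)` and of `(M', L_i')`. -/
def ProjectsTo (M : V →ₗ[ℂ] Matrix (Fin 3) (Fin 3) ℂ) (L : Fin 3 → Module.Dual ℂ V) (i : Fin 3)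
    (x : L3) (v : V) : Prop :=
  ∃ w ∈ galeKernel M L,
    (L (i + 1) v = w.2 (i + 2) ∧ L (i + 2) v = w.2 (i + 1)) ∧
    matE x = M v ∧ linE x = L i v ∧ matF x = w.1 ∧ linF x = w.2 i

/-- The Lagrangian `A_i ⊂ Λ³V₆`. -/
def lagrangian (M : V →ₗ[ℂ] Matrix (Fin 3) (Fin 3) ℂ) (L : Fin 3 → Module.Dual ℂ V) (i : Fin 3) :
    Submodule ℂ L3 where
  carrier := {x | ∃ v, ProjectsTo M L i x v}
  zero_mem' := ⟨0, 0, Submodule.zero_mem _, by simp, by ext; simp [matE], by simp,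
    by ext; simp [matF], by simp⟩
  add_mem' := by
    rintro x y ⟨v, w, hw, ⟨h1, h2⟩, h3, h4, h5, h6⟩ ⟨v', w', hw', ⟨h1', h2'⟩, h3', h4', h5', h6'⟩
    refine ⟨v + v', w + w', Submodule.add_mem _ hw hw', ⟨?_, ?_⟩, ?_, ?_, ?_, ?_⟩
    · simp [h1, h1']
    · simp [h2, h2']
    · simp [matE_add, h3, h3']
    · simp [h4, h4']
    · simp [matF_add, h5, h5']
    · simp [h6, h6']
  smul_mem' := by
    rintro c x ⟨v, w, hw, ⟨h1, h2⟩, h3, h4, h5, h6⟩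
    refine ⟨c • v, c • w, Submodule.smul_mem _ c hw, ⟨?_, ?_⟩, ?_, ?_, ?_, ?_⟩
    · simp [h1]
    · simp [h2]
    · simp [matE_smul, h3]
    · simp [h4]
    · simp [matF_smul, h5]
    · simp [h6]

/-! ### EPW sextics -/

/-- `Λ³U ⊂ Λ³V₆` for a subspace `U ⊂ V₆`. -/
def cubeOf (U : Submodule ℂ V6) : Submodule ℂ L3 :=
  LinearMap.range (exteriorPower.map 3 U.subtype)

/-- The EPW sextic `Y_{A^⊥} ⊂ ℙ(V₆^*)`: the hyperplanes `V₅ ⊂ V₆` with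
`dim (A ∩ Λ³V₅) ≥ 1`. -/
def epwSextic (A : Submodule ℂ L3) : Set (ℙ ℂ (Module.Dual ℂ V6)) :=
  {p | 1 ≤ Module.finrank ℂ ↥(A ⊓ cubeOf p.submodule.dualCoannihilator)}

/-- The linear form `e + f ∈ V₆^* = E^* ⊕ F^*` with coordinates `(e, f)`. -/
def pointForm (e f : Fin 3 → ℂ) : Module.Dual ℂ V6 :=
  ∑ i, e i • eForm i + ∑ j, f j • fForm j

lemma pointForm_ne_zero {e : Fin 3 → ℂ} (f : Fin 3 → ℂ) (he : e ≠ 0) : pointForm e f ≠ 0 := by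
  intro h
  apply he
  funext i
  have := congrArg (fun φ : Module.Dual ℂ V6 => φ (Pi.single i 1, 0)) h
  simpa [pointForm, eForm, fForm, Pi.single_apply] using this

/-- The hyperplane `V₅ ⊂ V₆` defined by `e + f`. -/
def hyperplane (e f : Fin 3 → ℂ) : Submodule ℂ V6 := LinearMap.ker (pointForm e f)

/-! ### The varieties in `ℙ(Λ³V₆)` -/

/-- The `σ`-quadric `σ = tr(M_E M_F^t) + L_E L_F`. -/
def sigma (x : L3) : ℂ := (matE x * (matF x).transpose).trace + linE x * linF x

/-- The equation `2 det M_E - σ L_E` of the cubic hypersurface in `ℙ(Λ³V₆)`. -/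
def bigCubic (x : L3) : ℂ := 2 * (matE x).det - sigma x * linE x

/-- (The cone over) `{M_E f + e L_E = 0} ⊂ ℙ(Λ³V₆)`. -/
def bigPlane (e f : Fin 3 → ℂ) : Submodule ℂ L3 where
  carrier := {x | (matE x).mulVec f + linE x • e = 0}
  zero_mem' := by
    have h : matE (0 : L3) = 0 := by ext; simp [matE]
    simp [h]
  add_mem' := by
    intro a b ha hb
    simp only [Set.mem_ofPred_eq] at *
    rw [matE_add, map_add, Matrix.add_mulVec, add_smul, add_add_add_comm, ha, hb, add_zero]
  smul_mem' := by
    intro c a ha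
    simp only [Set.mem_ofPred_eq] at *
    rw [matE_smul, map_smul, Matrix.smul_mulVec, smul_assoc, ← smul_add, ha, smul_zero]

/-- (The cone over) the hyperplane `{y | x ∧ y = 0}` of `ℙ(Λ³V₆)` orthogonal to `x`, the wedge
product being taken in the exterior algebra of `V₆`. -/
def orthogonalHyperplane (x : L3) : Submodule ℂ L3 :=
  LinearMap.ker (LinearMap.mulLeft ℂ (x : ExteriorAlgebra ℂ V6) ∘ₗ (⋀[ℂ]^3 V6).subtype)

end GaleEPW

end

open GaleEPW

noncomputable section
namespace GaleEPW

/-! ### A basis of `Λ³V₆` and the wedge product in coordinates -/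

/-! On a plane where `A f + a e = 0`, the adjugate gives `f_j det A = -a (adj(A) e)_j`. Since `f ≠
0`, choosing `f_j ≠ 0` makes both residual quadrics explicit in terms of `adjForm`. Vanishing of `(e
+ f) ∧ b ∧ c` on `Λ³V₅` gives linear relations between the `E`- and `F`-coordinates of `x`. By
`adjForm_polar`, these turn the polar form of `adjForm` at `M_E(x)` into a pairing with `(M_F(x),
L_F(x))`.

In `Λ³V₆`, subtracting the polar form of `σ` leaves minus the symplectic form, whence tangency;
`mul_eq_symplectic_smul` identifies that form with the wedge product. On `Π_i(e,f)`, adding the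
polar form of `L_j L_k` gives the Gale pairing of `w ∈ V^⊥` with a vector of `V`, which is zero, so
`v` is in the radical of the conic (`planeResidual_polar`). It remains to see that `v ≠ 0`
(`ne_zero_of_projectsTo`); this uses that `Π_i(e,f)` has the expected dimension. -/

/-- The standard basis of `V₆ = E ⊕ F`. -/
def stdBasis : Module.Basis (Fin 3 ⊕ Fin 3) ℂ V6 :=
  (Pi.basisFun ℂ (Fin 3)).prod (Pi.basisFun ℂ (Fin 3))

/-- The coordinates on `V₆ = E ⊕ F`. -/
def stdForm : Fin 3 ⊕ Fin 3 → Module.Dual ℂ V6 := Sum.elim eForm fForm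

lemma stdForm_stdBasis (s t : Fin 3 ⊕ Fin 3) :
    stdForm s (stdBasis t) = if s = t then 1 else 0 := by
  rcases s with s | s <;> rcases t with t | t <;>
    simp [stdForm, stdBasis, eForm, fForm, Pi.single_apply]

/-- Indices of the coordinates `(L_E, M_E; L_F, M_F)`. -/
abbrev CubeIndex : Type := (Unit ⊕ Fin 3 × Fin 3) ⊕ (Unit ⊕ Fin 3 × Fin 3)

/-- The coordinates of `V₆` whose wedge product is, up to sign, the coordinate of `Λ³V₆` with
a given index. Complementary triples are interchanged by `Sum.swap`. -/
def triple : CubeIndex → Fin 3 → Fin 3 ⊕ Fin 3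
  | .inl (.inl _) => ![.inl 0, .inl 1, .inl 2]
  | .inl (.inr (i, j)) => ![.inl (i + 1), .inl (i + 2), .inr j]
  | .inr (.inl _) => ![.inr 0, .inr 1, .inr 2]
  | .inr (.inr (i, j)) => ![.inl i, .inr (j + 1), .inr (j + 2)]

/-- The ordering of the coordinates of `V₆`. -/
def sixEquiv : Fin 6 ≃ Fin 3 ⊕ Fin 3 := (finSumFinEquiv (m := 3) (n := 3)).symm

/-- The sign of the permutation consisting of a triple followed by its complement. -/
def tripleSign : CubeIndex → ℤˣ
  | .inl (.inl _) => 1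
  | .inl (.inr _) => -1
  | .inr (.inl _) => -1
  | .inr (.inr _) => 1

/-- Over `ℤ` the duality of the decomposable vectors and the coordinates is a finite computation; it
is cast to `ℂ` afterwards. -/
lemma det_triple (I J : CubeIndex) :
    (Matrix.of fun i j => if triple I j = triple J i then (1 : ℤ) else 0).det =
      if I = J then 1 else 0 := by
  rw [Matrix.det_fin_three]
  revert I J
  decide +kernel

/-- Two triples that are not complementary share an index, so the wedge product of their vectors has
a repeated factor. -/
lemma append_triple_of_ne (I J : CubeIndex) (h : J ≠ I.swap) :
    ∃ a b, a ≠ b ∧ Fin.append (triple I) (triple J) a = Fin.append (triple I) (triple J) b := by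
  revert I J
  decide +kernel

lemma append_triple_swap (I : CubeIndex) :
    ∃ σ : Equiv.Perm (Fin 6), Equiv.Perm.sign σ = tripleSign I ∧
      ∀ k, Fin.append (triple I) (triple I.swap) k = sixEquiv (σ k) := by
  revert I
  decide +kernel

/-- The decomposable vector of `Λ³V₆` with a given index. -/
def cubeVec (I : CubeIndex) : L3 := exteriorPower.ιMulti ℂ 3 (stdBasis ∘ triple I)

/-- The coordinate of `Λ³V₆` with a given index. -/
def cubeCoord (I : CubeIndex) : Module.Dual ℂ L3 :=
  exteriorPower.pairingDual ℂ V6 3 (exteriorPower.ιMulti ℂ 3 (stdForm ∘ triple I))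

lemma cubeCoord_cubeVec (I J : CubeIndex) :
    cubeCoord I (cubeVec J) = if I = J then 1 else 0 := by
  have h := congrArg (Int.castRingHom ℂ) (det_triple I J)
  rw [RingHom.map_det] at h
  rw [cubeCoord, cubeVec, exteriorPower.pairingDual_ιMulti_ιMulti]
  convert h using 2
  · ext i j
    simp [stdForm_stdBasis, apply_ite]
  · split_ifs <;> simp

/-- The vector with given coordinates. -/
def cubeMk : (CubeIndex → ℂ) →ₗ[ℂ] L3 := Fintype.linearCombination ℂ cubeVec

lemma cubeCoord_cubeMk (c : CubeIndex → ℂ) (I : CubeIndex) : cubeCoord I (cubeMk c) = c I := by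
  simp only [cubeMk, Fintype.linearCombination_apply, map_sum, map_smul, cubeCoord_cubeVec,
    smul_eq_mul, mul_ite, mul_one, mul_zero, Finset.sum_ite_eq, Finset.mem_univ, if_true]

/-- The coordinates provide a left inverse, and both sides have dimension 20. -/
lemma cubeMk_surjective : Function.Surjective cubeMk := by
  have hinj : Function.Injective cubeMk := fun c d h => by
    funext I
    rw [← cubeCoord_cubeMk c, h, cubeCoord_cubeMk]
  refine (LinearMap.injective_iff_surjective_of_finrank_eq_finrank ?_).1 hinj
  rw [exteriorPower.finrank_eq]
  simp [Nat.choose]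

lemma cubeMk_cubeCoord (x : L3) : cubeMk (fun I => cubeCoord I x) = x := by
  obtain ⟨c, rfl⟩ := cubeMk_surjective x
  simp only [cubeCoord_cubeMk]

/-- The generator of `Λ⁶V₆`. -/
def volVec : ExteriorAlgebra ℂ V6 :=
  ExteriorAlgebra.ιMulti ℂ 6 (stdBasis ∘ sixEquiv)

lemma volVec_ne_zero : volVec ≠ 0 := by
  intro h
  let b := stdBasis.reindex sixEquiv.symm
  -- The determinant in degree 6, extended by zero to the other degrees, is a functional that takes
  -- the value 1 on `volVec`.
  let D := ExteriorAlgebra.liftAlternating (R := ℂ) (M := V6) (N := ℂ)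
    (fun n => if h : n = 6 then h ▸ b.det else 0)
  have h1 : D volVec = 1 := by
    have hb : (stdBasis ∘ sixEquiv : Fin 6 → V6) = b := by
      funext k; simp [b]
    rw [volVec, hb, ExteriorAlgebra.liftAlternating_apply_ιMulti]
    simpa using b.det_self
  rw [h, map_zero] at h1
  exact zero_ne_one h1

lemma cubeVec_mul_cubeVec (I J : CubeIndex) :
    (cubeVec I : ExteriorAlgebra ℂ V6) * (cubeVec J : ExteriorAlgebra ℂ V6) =
      if J = I.swap then (((tripleSign I : ℤ) : ℂ)) • volVec else 0 := by
  have happ : (cubeVec I : ExteriorAlgebra ℂ V6) * (cubeVec J : ExteriorAlgebra ℂ V6) =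
      ExteriorAlgebra.ιMulti ℂ 6 (stdBasis ∘ Fin.append (triple I) (triple J)) := by
    rw [cubeVec, cubeVec, exteriorPower.ιMulti_apply_coe, exteriorPower.ιMulti_apply_coe,
      ExteriorAlgebra.ιMulti_mul_ιMulti]
    congr 1
    funext k
    refine Fin.addCases (m := 3) (n := 3) (fun a => ?_) (fun a => ?_) k
    · rw [Function.comp_apply, Fin.append_left, Fin.append_left, Function.comp_apply]
    · rw [Function.comp_apply, Fin.append_right, Fin.append_right, Function.comp_apply]
  rw [happ]
  split_ifs with h
  · subst h
    obtain ⟨σ, hσ, hk⟩ := append_triple_swap I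
    have : (stdBasis ∘ Fin.append (triple I) (triple I.swap)) =
        (stdBasis ∘ sixEquiv : Fin 6 → V6) ∘ σ := by
      funext k
      simp [hk]
    rw [this, AlternatingMap.map_perm, hσ, volVec, Units.smul_def, Int.cast_smul_eq_zsmul]
  · obtain ⟨a, b, hab, h⟩ := append_triple_of_ne I J h
    exact AlternatingMap.map_eq_zero_of_eq _ _ (congrArg stdBasis h) hab

/-- The symplectic form on `Λ³V₆` in coordinates. -/
def symplectic (x y : L3) : ℂ :=
  (matE x * (matF y).transpose).trace - (matE y * (matF x).transpose).trace +
    linE x * linF y - linE y * linF x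

lemma matE_eq_cubeCoord (x : L3) (i j : Fin 3) : matE x i j = cubeCoord (.inl (.inr (i, j))) x := by
  simp only [matE, wedge3, cubeCoord, Matrix.of_apply]
  congr 3

lemma matF_eq_cubeCoord (x : L3) (i j : Fin 3) : matF x i j = cubeCoord (.inr (.inr (i, j))) x := by
  simp only [matF, wedge3, cubeCoord, Matrix.of_apply]
  congr 3

lemma linE_eq_cubeCoord (x : L3) : linE x = cubeCoord (.inl (.inl ())) x := by
  simp only [linE, wedge3, cubeCoord]
  congr 3

lemma linF_eq_cubeCoord (x : L3) : linF x = -cubeCoord (.inr (.inl ())) x := by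
  simp only [linF, wedge3, cubeCoord, LinearMap.neg_apply]
  congr 4

/-- In the double sum over decomposable vectors only complementary pairs survive. Their signs,
together with the sign in `linF`, produce the symplectic form up to a global minus. -/
lemma mul_eq_symplectic_smul (x y : L3) :
    (x : ExteriorAlgebra ℂ V6) * (y : ExteriorAlgebra ℂ V6) = (-symplectic x y) • volVec := by
  conv_lhs => rw [← cubeMk_cubeCoord x, ← cubeMk_cubeCoord y]
  simp only [cubeMk, Fintype.linearCombination_apply, Submodule.coe_sum, Submodule.coe_smul,
    Finset.sum_mul_sum, smul_mul_smul_comm, cubeVec_mul_cubeVec, smul_ite, smul_zero,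
    Finset.sum_ite_eq', Finset.mem_univ, if_true, smul_smul, ← Finset.sum_smul]
  congr 1
  simp only [symplectic, Matrix.trace, Matrix.diag_apply, Matrix.mul_apply, Matrix.transpose_apply,
    matE_eq_cubeCoord, matF_eq_cubeCoord, linE_eq_cubeCoord, linF_eq_cubeCoord,
    Fintype.sum_sum_type, Fintype.sum_prod_type, Finset.univ_unique, Finset.sum_singleton,
    Fin.sum_univ_three, tripleSign, Sum.swap_inl, Sum.swap_inr]
  push_cast
  ring

lemma mem_orthogonalHyperplane {x y : L3} :
    y ∈ orthogonalHyperplane x ↔ symplectic x y = 0 := by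
  rw [orthogonalHyperplane, LinearMap.mem_ker]
  simp only [LinearMap.comp_apply, LinearMap.mulLeft_apply, Submodule.subtype_apply]
  rw [mul_eq_symplectic_smul, smul_eq_zero, neg_eq_zero, or_iff_left volVec_ne_zero]

lemma ext_coordinates {x y : L3} (hA : matE x = matE y) (ha : linE x = linE y)
    (hB : matF x = matF y) (hb : linF x = linF y) : x = y := by
  rw [← cubeMk_cubeCoord x, ← cubeMk_cubeCoord y]
  congr 1
  funext I
  rcases I with (_ | ⟨i, j⟩) | (_ | ⟨i, j⟩)
  · simpa [linE_eq_cubeCoord] using ha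
  · simpa [matE_eq_cubeCoord] using congrFun₂ hA i j
  · simpa [linF_eq_cubeCoord] using hb
  · simpa [matF_eq_cubeCoord] using congrFun₂ hB i j

lemma exists_matE_linE (A : Matrix (Fin 3) (Fin 3) ℂ) (a : ℂ) : ∃ x, matE x = A ∧ linE x = a := by
  refine ⟨cubeMk (Sum.elim (Sum.elim (fun _ => a) fun p => A p.1 p.2) 0), ?_, ?_⟩
  · ext i j
    rw [matE_eq_cubeCoord, cubeCoord_cubeMk]; rfl
  · rw [linE_eq_cubeCoord, cubeCoord_cubeMk]; rfl

/-! ### Coordinates of the vectors of `Λ³V₅` -/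

lemma wedge3_ιMulti (a b c : Module.Dual ℂ V6) (u : Fin 3 → V6) :
    wedge3 a b c (exteriorPower.ιMulti ℂ 3 u) =
      (Matrix.of fun i j => (![a, b, c] : Fin 3 → Module.Dual ℂ V6) j (u i)).det :=
  exteriorPower.pairingDual_ιMulti_ιMulti _ _

/-- On decomposable vectors the pairing is a determinant whose column of values of `φ` is zero. -/
lemma wedge3_eq_zero_of_mem_cubeOf {φ : Module.Dual ℂ V6} {x : L3}
    (hx : x ∈ cubeOf (LinearMap.ker φ)) (b c : Module.Dual ℂ V6) : wedge3 φ b c x = 0 := by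
  obtain ⟨z, rfl⟩ := hx
  have : wedge3 φ b c ∘ₗ exteriorPower.map 3 (LinearMap.ker φ).subtype = 0 := by
    ext u
    simp only [LinearMap.compAlternatingMap_apply, LinearMap.comp_apply,
      exteriorPower.map_apply_ιMulti, wedge3_ιMulti, LinearMap.zero_apply]
    refine Matrix.det_eq_zero_of_column_eq_zero 0 fun i => ?_
    simp
  exact LinearMap.congr_fun this z

section

variable (e f : Fin 3 → ℂ) (x : L3)

lemma pointForm_apply (u : V6) : pointForm e f u =
    e 0 * u.1 0 + e 1 * u.1 1 + e 2 * u.1 2 + (f 0 * u.2 0 + f 1 * u.2 1 + f 2 * u.2 2) := by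
  simp [pointForm, eForm, fForm, Fin.sum_univ_three]

/-- This and the next two lemmas express the equations `(e + f) ∧ b ∧ c = 0` of `Λ³V₅` in the
coordinates `(M_E, L_E; M_F, L_F)`. -/
lemma wedge3_pointForm_eForm_eForm (i : Fin 3) :
    wedge3 (pointForm e f) (eForm (i + 1)) (eForm (i + 2)) x =
      (matE x).mulVec f i + linE x * e i := by
  simp only [matE, linE, Matrix.mulVec, dotProduct, Matrix.of_apply, Fin.sum_univ_three]
  have : wedge3 (pointForm e f) (eForm (i + 1)) (eForm (i + 2)) =
      f 0 • wedge3 (eForm (i + 1)) (eForm (i + 2)) (fForm 0) +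
      f 1 • wedge3 (eForm (i + 1)) (eForm (i + 2)) (fForm 1) +
      f 2 • wedge3 (eForm (i + 1)) (eForm (i + 2)) (fForm 2) +
      e i • wedge3 (eForm 0) (eForm 1) (eForm 2) := by
    ext u
    simp only [LinearMap.compAlternatingMap_apply, LinearMap.add_apply, LinearMap.smul_apply,
      wedge3_ιMulti, Matrix.det_fin_three, Matrix.of_apply, smul_eq_mul]
    fin_cases i <;> simp [pointForm_apply, eForm, fForm] <;> ring
  rw [this]
  simp only [LinearMap.add_apply, LinearMap.smul_apply, smul_eq_mul]
  ring

lemma wedge3_pointForm_fForm_fForm (j : Fin 3) :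
    wedge3 (pointForm e f) (fForm (j + 1)) (fForm (j + 2)) x =
      (matF x).transpose.mulVec e j - linF x * f j := by
  simp only [matF, linF, Matrix.mulVec, dotProduct, Matrix.of_apply, Matrix.transpose_apply,
    Fin.sum_univ_three]
  have : wedge3 (pointForm e f) (fForm (j + 1)) (fForm (j + 2)) =
      e 0 • wedge3 (eForm 0) (fForm (j + 1)) (fForm (j + 2)) +
      e 1 • wedge3 (eForm 1) (fForm (j + 1)) (fForm (j + 2)) +
      e 2 • wedge3 (eForm 2) (fForm (j + 1)) (fForm (j + 2)) +
      f j • wedge3 (fForm 0) (fForm 1) (fForm 2) := by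
    ext u
    simp only [LinearMap.compAlternatingMap_apply, LinearMap.add_apply, LinearMap.smul_apply,
      wedge3_ιMulti, Matrix.det_fin_three, Matrix.of_apply, smul_eq_mul]
    fin_cases j <;> simp [pointForm_apply, eForm, fForm] <;> ring
  rw [this]
  simp only [LinearMap.add_apply, LinearMap.smul_apply, LinearMap.neg_apply, smul_eq_mul]
  ring

lemma wedge3_pointForm_eForm_fForm (i j : Fin 3) :
    wedge3 (pointForm e f) (eForm i) (fForm j) x =
      e (i + 2) * matE x (i + 1) j - e (i + 1) * matE x (i + 2) j +
        (f (j + 1) * matF x i (j + 2) - f (j + 2) * matF x i (j + 1)) := by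
  simp only [matE, matF, Matrix.of_apply]
  -- Indices such as `i + 1 + 1` stay unreduced so that each term is literally an entry of `matE` or
  -- `matF`.
  have : wedge3 (pointForm e f) (eForm i) (fForm j) =
      e (i + 2) • wedge3 (eForm (i + 1 + 1)) (eForm (i + 1 + 2)) (fForm j) -
      e (i + 1) • wedge3 (eForm (i + 2 + 1)) (eForm (i + 2 + 2)) (fForm j) +
      (f (j + 1) • wedge3 (eForm i) (fForm (j + 2 + 1)) (fForm (j + 2 + 2)) -
      f (j + 2) • wedge3 (eForm i) (fForm (j + 1 + 1)) (fForm (j + 1 + 2))) := by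
    ext u
    simp only [LinearMap.compAlternatingMap_apply, LinearMap.add_apply, LinearMap.sub_apply,
      LinearMap.smul_apply,
      wedge3_ιMulti, Matrix.det_fin_three, Matrix.of_apply, smul_eq_mul]
    fin_cases i <;> fin_cases j <;> simp [pointForm_apply, eForm, fForm] <;> ring
  rw [this]
  simp only [LinearMap.add_apply, LinearMap.sub_apply, LinearMap.smul_apply, smul_eq_mul]

end

/-! ### Residual quadrics -/

/-- Two residual quadrics agree off `l = 0`. At a point `w` of that hyperplane, apply the
parallelogram law to `w + u` and `w - u` with `l u ≠ 0`. -/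
lemma IsResidualQuadric.unique {W : Type*} [AddCommGroup W] [Module ℂ W] {S : Submodule ℂ W}
    {F : W → ℂ} {l : Module.Dual ℂ W} {q q' : QuadraticForm ℂ S} (hl : ∃ u : S, l u ≠ 0)
    (h : IsResidualQuadric S F l q) (h' : IsResidualQuadric S F l q') : q = q' := by
  have key : ∀ w : S, l w ≠ 0 → (q - q') w = 0 := fun w hw => by
    rw [sub_apply, sub_eq_zero]
    exact mul_left_cancel₀ hw ((h w).symm.trans (h' w))
  rw [← sub_eq_zero]
  ext w
  rw [zero_apply]
  by_cases hw : l w = 0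
  · obtain ⟨u, hu⟩ := hl
    have h1 := key (w + u) (by simpa [hw] using hu)
    have h2 := key (w + -u) (by simpa [hw] using hu)
    have h3 := key u hu
    rw [QuadraticMap.map_add (q - q')] at h1 h2
    rw [QuadraticMap.polar_neg_right, QuadraticMap.map_neg] at h2
    linear_combination (h1 + h2) / 2 - h3
  · exact key w hw

/-- The `j`-th coordinate of `adj(A) e`, as a quadratic form in the matrix `A`. -/
def adjForm (e : Fin 3 → ℂ) (j : Fin 3) : QuadraticForm ℂ (Matrix (Fin 3) (Fin 3) ℂ) :=
  ∑ k, e k • (QuadraticMap.linMulLin (Matrix.entryLinearMap ℂ ℂ (k + 1) (j + 1))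
      (Matrix.entryLinearMap ℂ ℂ (k + 2) (j + 2)) -
    QuadraticMap.linMulLin (Matrix.entryLinearMap ℂ ℂ (k + 1) (j + 2))
      (Matrix.entryLinearMap ℂ ℂ (k + 2) (j + 1)))

lemma adjForm_apply (e : Fin 3 → ℂ) (j : Fin 3) (A : Matrix (Fin 3) (Fin 3) ℂ) :
    adjForm e j A =
      ∑ k, e k * (A (k + 1) (j + 1) * A (k + 2) (j + 2) -
        A (k + 1) (j + 2) * A (k + 2) (j + 1)) := by
  simp [adjForm]

/-- Multiply `A f = -a e` by the adjugate of `A` and take the `j`-th coordinate. -/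
lemma mul_det_eq {A : Matrix (Fin 3) (Fin 3) ℂ} {e f : Fin 3 → ℂ} {a : ℂ}
    (h : A.mulVec f + a • e = 0) (j : Fin 3) : f j * A.det = -(a * adjForm e j A) := by
  have h0 := congrFun h 0
  have h1 := congrFun h 1
  have h2 := congrFun h 2
  simp only [Pi.add_apply, Matrix.mulVec, dotProduct, Fin.sum_univ_three, Pi.smul_apply,
    smul_eq_mul, Pi.zero_apply] at h0 h1 h2
  rw [Matrix.det_fin_three, adjForm_apply, Fin.sum_univ_three]
  fin_cases j <;> simp only [Fin.zero_eta, Fin.mk_one, Fin.reduceFinMk, Fin.isValue, Fin.reduceAdd,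
    zero_add]
  · linear_combination (A 1 1 * A 2 2 - A 1 2 * A 2 1) * h0 +
      (A 2 1 * A 0 2 - A 2 2 * A 0 1) * h1 + (A 0 1 * A 1 2 - A 0 2 * A 1 1) * h2
  · linear_combination (A 1 2 * A 2 0 - A 1 0 * A 2 2) * h0 +
      (A 2 2 * A 0 0 - A 2 0 * A 0 2) * h1 + (A 0 2 * A 1 0 - A 0 0 * A 1 2) * h2
  · linear_combination (A 1 0 * A 2 1 - A 1 1 * A 2 0) * h0 +
      (A 2 0 * A 0 1 - A 2 1 * A 0 0) * h1 + (A 0 0 * A 1 1 - A 0 1 * A 1 0) * h2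

/-- The polar form contracts `A'` with the cross product of `e` and the columns of `A`. The mixed
relations trade this for a contraction of `A'` with `f` and `B`, and the other two relations absorb
the terms in `A' f` and `Bᵗ e`. The result depends on `A` only through `B` and `b`. -/
lemma adjForm_polar {A A' B : Matrix (Fin 3) (Fin 3) ℂ} {e f : Fin 3 → ℂ} {a' b : ℂ}
    (hB : B.transpose.mulVec e = b • f)
    (hAB : ∀ i j, e (i + 2) * A (i + 1) j - e (i + 1) * A (i + 2) j +
      (f (j + 1) * B i (j + 2) - f (j + 2) * B i (j + 1)) = 0)
    (hA' : A'.mulVec f + a' • e = 0) (j : Fin 3) :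
    adjForm e j (A + A') - adjForm e j A - adjForm e j A' =
      -(f j * ((A' * B.transpose).trace + a' * b)) := by
  have h0 := congrFun hA' 0
  have h1 := congrFun hA' 1
  have h2 := congrFun hA' 2
  have hj := congrFun hB j
  have g01 := hAB 0 (j + 1)
  have g02 := hAB 0 (j + 2)
  have g11 := hAB 1 (j + 1)
  have g12 := hAB 1 (j + 2)
  have g21 := hAB 2 (j + 1)
  have g22 := hAB 2 (j + 2)
  simp only [adjForm_apply, Matrix.trace, Matrix.diag_apply, Matrix.mul_apply,
    Matrix.transpose_apply, Pi.add_apply, Matrix.add_apply, Matrix.mulVec, dotProduct,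
    Fin.sum_univ_three, Pi.smul_apply, smul_eq_mul, Pi.zero_apply] at h0 h1 h2 hj ⊢
  -- Columns `j + 1` and `j + 2` of `A'` contract with the mixed relations, and column `j` of `B`
  -- with `A' f + a' e = 0`, which supplies the missing `j`-th part of the trace. The cyclic indices
  -- only reduce once `j` is fixed.
  linear_combination (norm := skip) (B 0 j * h0 + B 1 j * h1 + B 2 j * h2) - a' * hj +
    (A' 0 (j + 1) * g02 - A' 0 (j + 2) * g01) + (A' 1 (j + 1) * g12 - A' 1 (j + 2) * g11) +
    (A' 2 (j + 1) * g22 - A' 2 (j + 2) * g21)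
  clear h0 h1 h2 hj g01 g02 g11 g12 g21 g22
  fin_cases j <;> simp only [Fin.zero_eta, Fin.mk_one, Fin.reduceFinMk, Fin.isValue, Fin.reduceAdd,
    zero_add] <;> ring

/-- `M_E`, as a linear map. -/
def matELin : L3 →ₗ[ℂ] Matrix (Fin 3) (Fin 3) ℂ where
  toFun := matE
  map_add' := matE_add
  map_smul' := matE_smul

/-- `M_F`, as a linear map. -/
def matFLin : L3 →ₗ[ℂ] Matrix (Fin 3) (Fin 3) ℂ where
  toFun := matF
  map_add' := matF_add
  map_smul' := matF_smul

/-- `σ`, as a quadratic form. -/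
def sigmaForm : QuadraticForm ℂ L3 :=
  ∑ i, ∑ j, QuadraticMap.linMulLin (Matrix.entryLinearMap ℂ ℂ i j ∘ₗ matELin)
    (Matrix.entryLinearMap ℂ ℂ i j ∘ₗ matFLin) + QuadraticMap.linMulLin linE linF

lemma sigmaForm_apply (x : L3) : sigmaForm x = sigma x := by
  simp [sigmaForm, sigma, Matrix.trace, Matrix.mul_apply, matELin, matFLin]

lemma sigma_polar (x y : L3) : sigma (x + y) - sigma x - sigma y =
    (matE x * (matF y).transpose).trace + (matE y * (matF x).transpose).trace +
      linE x * linF y + linE y * linF x := by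
  simp only [sigma, matE_add, matF_add, map_add, Matrix.transpose_add, Matrix.add_mul,
    Matrix.mul_add, Matrix.trace_add]
  ring

/-- The residual quadric in `{M_E f + e L_E = 0}`, in terms of a nonzero coordinate of `f`. -/
def bigResidual (e f : Fin 3 → ℂ) (j : Fin 3) : QuadraticForm ℂ ↥(bigPlane e f) :=
  (-2 * (f j)⁻¹) • (adjForm e j).comp (matELin ∘ₗ (bigPlane e f).subtype) +
    (-1 : ℂ) • sigmaForm.comp (bigPlane e f).subtype

lemma bigResidual_apply (e f : Fin 3 → ℂ) (j : Fin 3) (y : bigPlane e f) :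
    bigResidual e f j y = -2 * (f j)⁻¹ * adjForm e j (matE y) - sigma y := by
  simp [bigResidual, sigmaForm_apply, matELin, sub_eq_add_neg]

lemma isResidualQuadric_bigResidual {e f : Fin 3 → ℂ} {j : Fin 3} (hf : f j ≠ 0) :
    IsResidualQuadric (bigPlane e f) bigCubic linE (bigResidual e f j) := by
  intro y
  have h := mul_det_eq y.2 j
  rw [bigResidual_apply, bigCubic]
  field_simp
  linear_combination 2 * h

/-- The residual conic in `Π_i(e,f)`, in terms of a nonzero coordinate of `f`. -/
def planeResidual (M : V →ₗ[ℂ] Matrix (Fin 3) (Fin 3) ℂ) (L : Fin 3 → Module.Dual ℂ V) (i : Fin 3)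
    (e f : Fin 3 → ℂ) (j : Fin 3) : QuadraticForm ℂ ↥(planeSpace M L i e f) :=
  (-(f j)⁻¹) • (adjForm e j).comp (M ∘ₗ (planeSpace M L i e f).subtype) +
    (QuadraticMap.linMulLin (L (i + 1)) (L (i + 2))).comp (planeSpace M L i e f).subtype

section

variable {M : V →ₗ[ℂ] Matrix (Fin 3) (Fin 3) ℂ} {L : Fin 3 → Module.Dual ℂ V} {i : Fin 3}
  {e f : Fin 3 → ℂ}

lemma planeResidual_apply (j : Fin 3) (v : planeSpace M L i e f) :
    planeResidual M L i e f j v =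
      -(f j)⁻¹ * adjForm e j (M v) + L (i + 1) v * L (i + 2) v := by
  simp [planeResidual]

lemma isResidualQuadric_planeResidual {j : Fin 3} (hf : f j ≠ 0) :
    IsResidualQuadric (planeSpace M L i e f) (cubic M L) (L i) (planeResidual M L i e f j) := by
  intro v
  have h := mul_det_eq v.2 j
  have hL : L 0 (v : V) * L 1 v * L 2 v = L i v * L (i + 1) v * L (i + 2) v := by
    fin_cases i <;> simp <;> ring
  rw [planeResidual_apply, cubic, hL]
  field_simp
  linear_combination h

/-! ### Consequences of the dimension hypotheses -/

/-- If `L_i` vanished on the plane, the plane would be contained in the line. -/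
lemma exists_linear_form_ne_zero (hplane : Module.finrank ℂ ↥(planeSpace M L i e f) = 3)
    (hline : Module.finrank ℂ ↥(lineSpace M L i f) = 2) :
    ∃ u : planeSpace M L i e f, L i u ≠ 0 := by
  by_contra! h
  have hle : planeSpace M L i e f ≤ lineSpace M L i f := fun v hv => by
    have h0 : L i v = 0 := h ⟨v, hv⟩
    have h1 : (M v).mulVec f + L i v • e = 0 := hv
    exact ⟨by simpa [h0] using h1, h0⟩
  have := Submodule.finrank_mono hle
  omega

lemma ne_zero_of_linear_form_ne_zero (he : e ≠ 0) (h : ∃ u : planeSpace M L i e f, L i u ≠ 0) :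
    f ≠ 0 := by
  rintro rfl
  obtain ⟨u, hu⟩ := h
  have h1 : (M u).mulVec 0 + L i u • e = 0 := u.2
  rw [Matrix.mulVec_zero, zero_add, smul_eq_zero] at h1
  exact h1.elim hu he

/-- The linear map `M f + e L_i` whose kernel is `Π_i(e,f)`. -/
def planeMap (M : V →ₗ[ℂ] Matrix (Fin 3) (Fin 3) ℂ) (L : Fin 3 → Module.Dual ℂ V) (i : Fin 3)
    (e f : Fin 3 → ℂ) : V →ₗ[ℂ] (Fin 3 → ℂ) where
  toFun v := (M v).mulVec f + L i v • e
  map_add' a b := by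
    rw [map_add, map_add, Matrix.add_mulVec, add_smul, add_add_add_comm]
  map_smul' c a := by
    rw [map_smul, map_smul, Matrix.smul_mulVec, smul_assoc, ← smul_add, RingHom.id_apply]

/-- The rank is `6 - 3 = 3`: the three equations of the plane are independent. -/
lemma planeMap_surjective (hplane : Module.finrank ℂ ↥(planeSpace M L i e f) = 3) :
    Function.Surjective (planeMap M L i e f) := by
  have hker : LinearMap.ker (planeMap M L i e f) = planeSpace M L i e f := rfl
  have h := LinearMap.finrank_range_add_finrank_ker (planeMap M L i e f)
  rw [hker, hplane, Module.finrank_fin_fun] at h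
  rw [← LinearMap.range_eq_top]
  refine Submodule.eq_top_of_finrank_eq ?_
  rw [Module.finrank_fin_fun]
  omega

lemma eq_zero_of_dotProduct_planeMap (hplane : Module.finrank ℂ ↥(planeSpace M L i e f) = 3)
    {g : Fin 3 → ℂ} (hg : ∀ v, g ⬝ᵥ ((M v).mulVec f + L i v • e) = 0) : g = 0 := by
  funext k
  obtain ⟨v, hv⟩ := planeMap_surjective hplane (Pi.single k 1)
  have h1 : (M v).mulVec f + L i v • e = Pi.single k 1 := hv
  simpa [h1] using hg v

lemma sum_eq_cyclic (g : Fin 3 → ℂ) (i : Fin 3) : ∑ a, g a = g i + g (i + 1) + g (i + 2) := by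
  fin_cases i <;> simp [Fin.sum_univ_three] <;> ring

lemma trace_mul_transpose_eq (A B : Matrix (Fin 3) (Fin 3) ℂ) :
    (A * B.transpose).trace = ∑ a, ∑ b, B a b * A a b := by
  simp [Matrix.trace, Matrix.mul_apply, mul_comm]

/-! ### The tangent hyperplane and the singular point -/

section

variable {x : L3} (hx : x ∈ cubeOf (hyperplane e f))
include hx

lemma mem_bigPlane_of_mem_cubeOf : x ∈ bigPlane e f := by
  change (matE x).mulVec f + linE x • e = 0
  funext k
  have := wedge3_pointForm_eForm_eForm e f x k
  rw [wedge3_eq_zero_of_mem_cubeOf hx] at this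
  simpa using this.symm

lemma transpose_matF_mulVec : (matF x).transpose.mulVec e = linF x • f := by
  funext k
  have := wedge3_pointForm_fForm_fForm e f x k
  rw [wedge3_eq_zero_of_mem_cubeOf hx] at this
  simpa [sub_eq_zero] using this.symm

lemma mixed_relation (i j : Fin 3) :
    e (i + 2) * matE x (i + 1) j - e (i + 1) * matE x (i + 2) j +
      (f (j + 1) * matF x i (j + 2) - f (j + 2) * matF x i (j + 1)) = 0 := by
  rw [← wedge3_pointForm_eForm_fForm, wedge3_eq_zero_of_mem_cubeOf hx]

/-- The adjugate part contributes twice the pairing of the `E`-part of `y` with the `F`-part of `x`;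
subtracting the symmetric polar form of `σ` makes it antisymmetric. -/
lemma bigResidual_polar {j : Fin 3} (hf : f j ≠ 0) (hx' : x ∈ bigPlane e f) (y : bigPlane e f) :
    (bigResidual e f j).polarBilin ⟨x, hx'⟩ y = -symplectic x y := by
  have h1 := adjForm_polar (transpose_matF_mulVec hx) (mixed_relation hx) y.2 j
  have h2 := sigma_polar x y
  change QuadraticMap.polar (bigResidual e f j) ⟨x, hx'⟩ y = _
  rw [QuadraticMap.polar]
  simp only [bigResidual_apply, Submodule.coe_add, matE_add, symplectic]
  have h3 : (f j)⁻¹ * f j = 1 := inv_mul_cancel₀ hf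
  linear_combination (-2 * (f j)⁻¹) * h1 - h2 +
    2 * ((matE y * (matF x).transpose).trace + linE y * linF x) * h3

/-- The symplectic form is alternating, and the polar form on the diagonal is twice the quadratic
form. -/
lemma bigResidual_eq_zero {j : Fin 3} (hf : f j ≠ 0) (hx' : x ∈ bigPlane e f) :
    bigResidual e f j ⟨x, hx'⟩ = 0 := by
  have h := bigResidual_polar hx hf hx' ⟨x, hx'⟩
  rw [QuadraticMap.polarBilin_apply_apply, QuadraticMap.polar_self, symplectic] at h
  simpa using h

lemma tangentSpace_bigResidual {j : Fin 3} (hf : f j ≠ 0) (hx' : x ∈ bigPlane e f) :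
    tangentSpace (W := ↥(bigPlane e f)) (bigResidual e f j) ⟨x, hx'⟩ =
      (orthogonalHyperplane x).comap (bigPlane e f).subtype := by
  ext y
  rw [tangentSpace, LinearMap.mem_ker, bigResidual_polar hx hf, neg_eq_zero, Submodule.mem_comap,
    Submodule.subtype_apply, mem_orthogonalHyperplane]

variable {v : V} (hv : ProjectsTo M L i x v)
include hv

lemma mem_planeSpace_of_projectsTo : v ∈ planeSpace M L i e f := by
  obtain ⟨w, -, -, hA, ha, -, -⟩ := hv
  have := mem_bigPlane_of_mem_cubeOf hx
  change (matE x).mulVec f + linE x • e = 0 at this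
  rwa [hA, ha] at this

/-- The crossed conditions `L_j(v) = L_k'(w)`, `L_k(v) = L_j'(w)` turn the polar form of `L_j L_k`
into exactly the two terms missing from the Gale relation between `w` and `u`. -/
lemma planeResidual_polar {j : Fin 3} (hf : f j ≠ 0) (hv' : v ∈ planeSpace M L i e f)
    (u : planeSpace M L i e f) :
    (planeResidual M L i e f j).polarBilin ⟨v, hv'⟩ u = 0 := by
  have h1 := adjForm_polar (transpose_matF_mulVec hx) (mixed_relation hx) u.2 j
  obtain ⟨w, hw, ⟨hj, hk⟩, hA, -, hB, hb⟩ := hv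
  have h2 := hw u
  rw [hA, hB, hb, trace_mul_transpose_eq] at h1
  rw [sum_eq_cyclic (fun a => w.2 a * L a u) i] at h2
  rw [QuadraticMap.polarBilin_apply_apply, QuadraticMap.polar]
  simp only [planeResidual_apply, Submodule.coe_add, map_add, hj, hk]
  have h3 : (f j)⁻¹ * f j = 1 := inv_mul_cancel₀ hf
  linear_combination (-(f j)⁻¹) * h1 + h2 +
    (∑ a, ∑ b, w.1 a b * M u a b + L i u * w.2 i) * h3

/-- If `v = 0`, the `E`-part of `x` vanishes and every row of `M_F(x)` is proportional to `f`. The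
Gale relation then says that the column of proportionality factors is orthogonal to the image of `M
f + e L_i`, which is all of `ℂ³`; so the `F`-part vanishes too. -/
lemma ne_zero_of_projectsTo {j : Fin 3} (hf : f j ≠ 0)
    (hplane : Module.finrank ℂ ↥(planeSpace M L i e f) = 3) (hx0 : x ≠ 0) : v ≠ 0 := by
  rintro rfl
  obtain ⟨w, hw, ⟨hj, hk⟩, hA, ha, hB, hb⟩ := hv
  rw [map_zero] at hj hk hA ha
  have hB' := transpose_matF_mulVec hx
  -- With `M_E(x) = 0`, the mixed relations are the `2 × 2` minors of a row of `M_F(x)` against `f`.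
  have hrow : ∀ k l, f j * matF x k l = matF x k j * f l := by
    intro k l
    have h := mixed_relation hx k
    simp only [hA, Matrix.zero_apply, mul_zero, sub_zero, zero_add, sub_eq_zero] at h
    have h0 := h 0
    have h1 := h 1
    have h2 := h 2
    simp only [Fin.isValue, Fin.reduceAdd, zero_add] at h0 h1 h2
    fin_cases j <;> fin_cases l <;>
      simp only [Fin.zero_eta, Fin.mk_one, Fin.reduceFinMk, Fin.isValue] <;>
      first
      | ring1
      | linear_combination h0
      | linear_combination h1
      | linear_combination h2
      | linear_combination -h0
      | linear_combination -h1
      | linear_combination -h2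
  have hcol : ∑ k, matF x k j * e k = linF x * f j := by
    simpa [Matrix.mulVec, dotProduct] using congrFun hB' j
  have hg : (fun k => matF x k j) = 0 := by
    refine eq_zero_of_dotProduct_planeMap hplane fun v => ?_
    have h := hw v
    -- The crossed conditions at the zero vector kill `L_j'(w)` and `L_k'(w)`, so only the `L_i'`
    -- term remains.
    rw [sum_eq_cyclic (fun a => w.2 a * L a v) i, ← hj, ← hk, ← hB, ← hb] at h
    rw [dotProduct_add, dotProduct_smul]
    have h1 : (fun k => matF x k j) ⬝ᵥ (M v).mulVec f =
        f j * ∑ a, ∑ b, matF x a b * M v a b := by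
      simp only [dotProduct, Matrix.mulVec, Finset.mul_sum]
      refine Finset.sum_congr rfl fun a _ => Finset.sum_congr rfl fun b _ => ?_
      linear_combination -M v a b * hrow a b
    have h2 : (fun k => matF x k j) ⬝ᵥ e = linF x * f j := hcol
    rw [h1, h2, smul_eq_mul]
    linear_combination f j * h
  have hF : matF x = 0 := by
    ext k l
    have h := hrow k l
    rw [show matF x k j = 0 from congrFun hg k, zero_mul] at h
    exact (mul_eq_zero.1 h).resolve_left hf
  have hb0 : linF x = 0 := by
    rw [hF] at hcol
    simp only [Matrix.zero_apply, zero_mul, Finset.sum_const_zero] at hcol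
    exact (mul_eq_zero.1 hcol.symm).resolve_right hf
  have hE0 : matE (0 : L3) = 0 := map_zero matELin
  have hF0 : matF (0 : L3) = 0 := map_zero matFLin
  exact hx0 (ext_coordinates (by rw [hA, hE0]) (by rw [ha, map_zero]) (by rw [hF, hF0])
    (by rw [hb0, map_zero]))

lemma isSingularPoint_planeResidual {j : Fin 3} (hf : f j ≠ 0)
    (hplane : Module.finrank ℂ ↥(planeSpace M L i e f) = 3) (hx0 : x ≠ 0)
    (hv' : v ∈ planeSpace M L i e f) :
    IsSingularPoint (W := ↥(planeSpace M L i e f)) (planeResidual M L i e f j) ⟨v, hv'⟩ := by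
  have hpolar := planeResidual_polar hx hv hf hv'
  refine ⟨fun h => ne_zero_of_projectsTo hx hv hf hplane hx0 (congrArg Subtype.val h), ?_, ?_⟩
  · have h := hpolar ⟨v, hv'⟩
    rw [QuadraticMap.polarBilin_apply_apply, QuadraticMap.polar_self] at h
    simpa using h
  · rw [tangentSpace, LinearMap.ker_eq_top]
    exact LinearMap.ext hpolar

end

lemma exists_linE_ne_zero {j : Fin 3} (hf : f j ≠ 0) : ∃ y : bigPlane e f, linE y ≠ 0 := by
  -- This rank-one matrix sends `f` to `-e`, which balances `L_E = 1`.
  obtain ⟨y, hA, ha⟩ := exists_matE_linE (Matrix.vecMulVec (-e) (Pi.single j (f j)⁻¹)) 1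
  refine ⟨⟨y, ?_⟩, by simp [ha]⟩
  change (matE y).mulVec f + linE y • e = 0
  rw [hA, ha, Matrix.vecMulVec_mulVec]
  simp [hf]

lemma exists_mem_of_mem_epwSextic {A : Submodule ℂ L3} (h : pointForm e f ≠ 0)
    (hY : Projectivization.mk ℂ (pointForm e f) h ∈ epwSextic A) :
    ∃ x ∈ A ⊓ cubeOf (hyperplane e f), x ≠ 0 := by
  have hU : (Projectivization.mk ℂ (pointForm e f) h).submodule.dualCoannihilator =
      hyperplane e f := by
    ext u
    rw [Projectivization.submodule_mk, Submodule.mem_dualCoannihilator, hyperplane,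
      LinearMap.mem_ker]
    refine ⟨fun hu => hu _ (Submodule.mem_span_singleton_self _), fun hu φ hφ => ?_⟩
    obtain ⟨c, rfl⟩ := Submodule.mem_span_singleton.1 hφ
    simp [hu]
  rw [epwSextic, Set.mem_ofPred_eq, hU] at hY
  refine Submodule.exists_mem_ne_zero_of_ne_bot fun hbot => ?_
  rw [hbot, finrank_bot] at hY
  omega

end

end GaleEPW

end

theorem proposition5p7
    (M : V →ₗ[ℂ] Matrix (Fin 3) (Fin 3) ℂ) (L : Fin 3 → Module.Dual ℂ V) (i : Fin 3)
    (e f : Fin 3 → ℂ) (he : e ≠ 0)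
    -- `Π_i(e,f)` is a plane and `Γ_i(f)` is a line
    (hplane : Module.finrank ℂ ↥(planeSpace M L i e f) = 3)
    (hline : Module.finrank ℂ ↥(lineSpace M L i f) = 2)
    -- `(e,f)` is a point of the EPW sextic of `A_i`
    (hY : Projectivization.mk ℂ (pointForm e f) (pointForm_ne_zero f he) ∈
      epwSextic (lagrangian M L i)) :
    -- the residual conic `C_i(e,f)` is well defined
    (∃! q : QuadraticForm ℂ ↥(planeSpace M L i e f),
      IsResidualQuadric (planeSpace M L i e f) (cubic M L) (L i) q) ∧
    -- so is the residual quadric in `ℙ(Λ³V₆)`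
    (∃! Q : QuadraticForm ℂ ↥(bigPlane e f),
      IsResidualQuadric (bigPlane e f) bigCubic linE Q) ∧
    ∀ q : QuadraticForm ℂ ↥(planeSpace M L i e f),
      IsResidualQuadric (planeSpace M L i e f) (cubic M L) (L i) q →
      -- the conic is singular
      (∃ p : ↥(planeSpace M L i e f), IsSingularPoint q p) ∧
      ∀ Q : QuadraticForm ℂ ↥(bigPlane e f),
        IsResidualQuadric (bigPlane e f) bigCubic linE Q →
        ∀ x ∈ lagrangian M L i ⊓ cubeOf (hyperplane e f), x ≠ 0 →
          -- `x` lies on the residual quadric, where the hyperplane orthogonal to `x` is tangent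
          (∃ hx : x ∈ bigPlane e f, Q ⟨x, hx⟩ = 0 ∧
            tangentSpace (W := ↥(bigPlane e f)) Q ⟨x, hx⟩ =
              (orthogonalHyperplane x).comap (bigPlane e f).subtype) ∧
          -- the image of `x` is a singular point of the conic
          ∀ v, ProjectsTo M L i x v →
            ∃ hv : v ∈ planeSpace M L i e f, IsSingularPoint (W := ↥(planeSpace M L i e f)) q ⟨v, hv⟩ := by
  have hl := exists_linear_form_ne_zero hplane hline
  obtain ⟨j, hf⟩ := Function.ne_iff.1 (ne_zero_of_linear_form_ne_zero he hl)
  rw [Pi.zero_apply] at hf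
  have hq := isResidualQuadric_planeResidual (M := M) (L := L) (i := i) (e := e) hf
  have hQ := isResidualQuadric_bigResidual (e := e) hf
  refine ⟨⟨_, hq, fun q' h => h.unique hl hq⟩,
    ⟨_, hQ, fun Q' h => h.unique (exists_linE_ne_zero hf) hQ⟩, fun q h => ?_⟩
  -- By uniqueness, the given conic is the explicit one, whatever the choice of `j`.
  obtain rfl := h.unique hl hq
  have hsing : ∀ x ∈ lagrangian M L i ⊓ cubeOf (hyperplane e f), x ≠ 0 →
      ∀ v, ProjectsTo M L i x v → ∃ hv : v ∈ planeSpace M L i e f,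
        IsSingularPoint (W := ↥(planeSpace M L i e f)) (planeResidual M L i e f j) ⟨v, hv⟩ := fun x hx hx0 v hv =>
    ⟨mem_planeSpace_of_projectsTo hx.2 hv, isSingularPoint_planeResidual hx.2 hv hf hplane hx0 _⟩
  refine ⟨?_, fun Q h' x hx hx0 => ⟨?_, hsing x hx hx0⟩⟩
  · obtain ⟨x, hx, hx0⟩ := exists_mem_of_mem_epwSextic _ hY
    obtain ⟨v, hv⟩ := hx.1
    obtain ⟨hv', h⟩ := hsing x hx hx0 v hv
    exact ⟨_, h⟩
  · obtain rfl := h'.unique (exists_linE_ne_zero hf) hQ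
    have hx' := mem_bigPlane_of_mem_cubeOf hx.2
    exact ⟨hx', bigResidual_eq_zero hx.2 hf hx', tangentSpace_bigResidual hx.2 hf hx'⟩
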